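/- Manifolds are smooth, of constant finite dimension, Hausdorff and without boundary, and Lie groups are in addition second countable. Let $M$ be a manifold of dimension $n$. An *s-space* over $M$ is a collection $\lambda=(N,\psi,O,R,\{e_i\})$ where - $N$ is a manifold (here assumed non-empty) and $\psi:N\to M$ is a submersion; - $O$ is a Lie group and $R$ is a smooth right action $R_a(z)=z.a$ of $O$ on $N$ such that $\psi\circ R_a=\psi$ for all $a\in O$, and $O$ acts transitively on each fibre of $\psi$; - $e_i:N\to TM$, $1\le i\le n$, are smooth maps such that $\{e_1(z),\dots,e_n(z)\}$ is a basis of $T_{\psi(z)}M$ for all $z\in N$. For $z\in N$ let $S_z=\{a\in O: z.a=z\}$ be the stabilizer of $z$. **Proposition.** Let $\lambda=(N,\psi,O,R,\{e_i\})$ be an s-space over $M$. Then there exists an integer $s\ge 0$ such that i) for all $z\in N$ the stabilizer $S_z$ is an embedded submanifold (hence a Lie subgroup) of $O$ with $\dim S_z=s$; ii) $\dim N=\dim M+\dim O-s$. -/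

import Mathlib

open scoped Manifold ContDiff

/-- An `s`-space `λ = (N, ψ, O, R, {e_i})` over the smooth manifold `M`: a smooth manifold `N`, a
submersion `ψ : N → M`, a Lie group `O` with a smooth right action `R z a = z.a` on `N` which
preserves the fibres of `ψ` and is transitive on each of them, and `n = dim M` smooth maps
`e_i : N → TM` such that `e_1(z), …, e_n(z)` is a basis of `T_{ψ(z)} M` for every `z`. -/
structure SSpace
    (E : Type*) [NormedAddCommGroup E] [NormedSpace ℝ E]
    (EN : Type*) [NormedAddCommGroup EN] [NormedSpace ℝ EN]
    (EO : Type*) [NormedAddCommGroup EO] [NormedSpace ℝ EO]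
    (M : Type*) [TopologicalSpace M] [ChartedSpace E M] [IsManifold 𝓘(ℝ, E) ∞ M]
    (N : Type*) [TopologicalSpace N] [ChartedSpace EN N] [IsManifold 𝓘(ℝ, EN) ∞ N]
    (O : Type*) [Group O] [TopologicalSpace O] [ChartedSpace EO O] [LieGroup 𝓘(ℝ, EO) ∞ O] where
  /-- the projection -/
  ψ : N → M
  isSubmersion_ψ : Manifold.IsSubmersion 𝓘(ℝ, EN) 𝓘(ℝ, E) ∞ ψ
  /-- the right action, `R z a = z.a` -/
  R : N → O → N
  contMDiff_R : ContMDiff (𝓘(ℝ, EN).prod 𝓘(ℝ, EO)) 𝓘(ℝ, EN) ∞ fun p : N × O => R p.1 p.2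
  R_one : ∀ z, R z 1 = z
  R_mul : ∀ z a b, R z (a * b) = R (R z a) b
  ψ_R : ∀ z a, ψ (R z a) = ψ z
  transitive : ∀ z w, ψ z = ψ w → ∃ a, R z a = w
  /-- the moving frame along `ψ` -/
  e : Fin (Module.finrank ℝ E) → (z : N) → TangentSpace 𝓘(ℝ, E) (ψ z)
  contMDiff_e : ∀ i, ContMDiff 𝓘(ℝ, EN) 𝓘(ℝ, E).tangent ∞
    fun z => (⟨ψ z, e i z⟩ : TangentBundle 𝓘(ℝ, E) M)
  linearIndependent_e : ∀ z, LinearIndependent ℝ fun i => e i z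
  span_e : ∀ z, Submodule.span ℝ (Set.range fun i => e i z) = ⊤

namespace SSpace

variable
  {E : Type*} [NormedAddCommGroup E] [NormedSpace ℝ E]
  {EN : Type*} [NormedAddCommGroup EN] [NormedSpace ℝ EN]
  {EO : Type*} [NormedAddCommGroup EO] [NormedSpace ℝ EO]
  {M : Type*} [TopologicalSpace M] [ChartedSpace E M] [IsManifold 𝓘(ℝ, E) ∞ M]
  {N : Type*} [TopologicalSpace N] [ChartedSpace EN N] [IsManifold 𝓘(ℝ, EN) ∞ N]
  {O : Type*} [Group O] [TopologicalSpace O] [ChartedSpace EO O] [LieGroup 𝓘(ℝ, EO) ∞ O]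

/-- The stabilizer `S_z = {a ∈ O : z.a = z}`. -/
def stabilizer (sp : SSpace E EN EO M N O) (z : N) : Subgroup O where
  carrier := {a | sp.R z a = z}
  one_mem' := sp.R_one z
  mul_mem' := by
    intro a b ha hb
    change sp.R z (a * b) = z
    rw [sp.R_mul, show sp.R z a = z from ha, show sp.R z b = z from hb]
  inv_mem' := by
    intro a ha
    change sp.R z a⁻¹ = z
    have h := sp.R_mul z a a⁻¹
    rw [mul_inv_cancel, sp.R_one, show sp.R z a = z from ha] at h
    exact h.symm

end SSpace

/-- `S` is an embedded smooth submanifold of dimension `d` of the smooth manifold `X`: around each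
of its points there is a smooth chart of `X` in which `S` is a `d`-dimensional affine subspace.
A subgroup of a Lie group with this property is an embedded Lie subgroup of dimension `d`. -/
def IsEmbeddedSubmanifold {E : Type*} [NormedAddCommGroup E] [NormedSpace ℝ E]
    {X : Type*} [TopologicalSpace X] [ChartedSpace E X] (S : Set X) (d : ℕ) : Prop :=
  ∀ x ∈ S, ∃ φ ∈ IsManifold.maximalAtlas 𝓘(ℝ, E) ∞ X, x ∈ φ.source ∧
    ∃ V : Submodule ℝ E, FiniteDimensional ℝ V ∧ Module.finrank ℝ V = d ∧
      ∀ y ∈ φ.source, y ∈ S ↔ φ y - φ x ∈ V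

/-! Fix `z` and let `θ a = z.a`. By transitivity `θ` maps `O` onto the fibre of `ψ` through `z`, a
submanifold of dimension `k = dim N - dim M`. Since `θ` intertwines right translation with the
action, its rank is a constant `r`. Read in a fibre coordinate `π` near `z`, it becomes a map `g = π
∘ θ` of the same rank, defined on an open subset of `O`, whose image contains a nonempty open set of
a `k`-dimensional space.

A map of constant rank `r` on a second countable manifold has image of Hausdorff dimension at most
`r` (`dimH_image_le_of_diffRank_eq`), so `k ≤ r`. Hence `g` is a submersion, and `S_z` is one of its
fibres, embedded of dimension `s = dim O - k` (`isEmbeddedSubmanifold_of_diffRank_eq`). This number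
does not involve `z`. -/

open Topology Module

/-! ### Local normal forms and the constant rank theorem -/

/-- Straightening a map near a point where its derivative is onto: a smooth local diffeomorphism
of the source turns the map into its derivative. -/
theorem exists_straightening {E R : Type*} [NormedAddCommGroup E] [NormedSpace ℝ E]
    [FiniteDimensional ℝ E] [NormedAddCommGroup R] [NormedSpace ℝ R] [FiniteDimensional ℝ R]
    {g : E → R} {U : Set E} (hU : IsOpen U) (hg : ContDiffOn ℝ ∞ g U) {x₀ : E} (hx₀ : x₀ ∈ U)
    {L : E →L[ℝ] R} (hL : HasFDerivAt g L x₀) (hs : Function.Surjective L) :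
    ∃ Φ : OpenPartialHomeomorph E E, x₀ ∈ Φ.source ∧ Φ.source ⊆ U ∧
      ContDiffOn ℝ ∞ Φ Φ.source ∧ ContDiffOn ℝ ∞ Φ.symm Φ.target ∧
      ∀ x, L (Φ x - Φ x₀) = g x - g x₀ := by
  have : CompleteSpace E := FiniteDimensional.complete ℝ E
  obtain ⟨σ', hσ'⟩ := L.toLinearMap.exists_rightInverse_of_surjective
    (LinearMap.range_eq_top.2 hs)
  set σ : R →L[ℝ] E := σ'.toContinuousLinearMap
  have hσ : ∀ r, L (σ r) = r := fun r => LinearMap.congr_fun hσ' r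
  -- The correction term vanishes to first order at `x₀`, so `P` has derivative the identity there;
  -- `L ∘ σ = id` makes `L ∘ P` agree with `g` up to a constant.
  set P : E → E := fun x => x + σ (g x - g x₀ - L (x - x₀)) with hP
  have hPU : ContDiffOn ℝ ∞ P U :=
    contDiffOn_id.add (σ.contDiff.comp_contDiffOn ((hg.sub contDiffOn_const).sub
      (L.contDiff.comp_contDiffOn (contDiffOn_id.sub contDiffOn_const))))
  have hPx : HasFDerivAt P ((ContinuousLinearEquiv.refl ℝ E : E ≃L[ℝ] E) : E →L[ℝ] E) x₀ := by
    have h := (hasFDerivAt_id (𝕜 := ℝ) x₀).add (σ.hasFDerivAt.comp x₀ ((hL.sub_const (g x₀)).sub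
      (L.hasFDerivAt.comp x₀ ((hasFDerivAt_id (𝕜 := ℝ) x₀).sub_const x₀))))
    refine h.congr_fderiv ?_
    ext v
    simp
  have hPat : ∀ x ∈ U, ContDiffAt ℝ ∞ P x := fun x hx => hPU.contDiffAt (hU.mem_nhds hx)
  have hne : (∞ : WithTop ℕ∞) ≠ 0 := by simp
  set Ψ := (hPat x₀ hx₀).toOpenPartialHomeomorph P hPx hne
  have hcont : ContinuousOn (fderiv ℝ P) U := hPU.continuousOn_fderiv_of_isOpen hU (by simp)
  -- Smoothness of the inverse needs an invertible derivative at every point, not only at `x₀`; this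
  -- is an open condition.
  have hW : IsOpen (U ∩ fderiv ℝ P ⁻¹' Set.range ((↑) : (E ≃L[ℝ] E) → E →L[ℝ] E)) :=
    hcont.isOpen_inter_preimage hU ContinuousLinearEquiv.isOpen
  set W := U ∩ fderiv ℝ P ⁻¹' Set.range ((↑) : (E ≃L[ℝ] E) → E →L[ℝ] E)
  refine ⟨Ψ.restrOpen W hW, ⟨ContDiffAt.mem_toOpenPartialHomeomorph_source _ hPx hne, hx₀,
    ⟨_, hPx.fderiv.symm⟩⟩, fun x hx => hx.2.1, hPU.mono fun x hx => hx.2.1, ?_, ?_⟩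
  · intro y hy
    have hx := (Ψ.restrOpen W hW).map_target hy
    obtain ⟨A, hA⟩ := hx.2.2
    have hd := ((hPat _ hx.2.1).differentiableAt hne).hasFDerivAt
    rw [← hA] at hd
    exact ((Ψ.restrOpen W hW).contDiffAt_symm hy hd (hPat _ hx.2.1)).contDiffWithinAt
  · intro x
    change L (P x - P x₀) = _
    simp only [hP, map_sub, map_add, hσ, sub_self, map_zero]
    abel

open Set in
/-- A smooth map of constant rank `r` has, locally, an image of dimension at most `r`. -/
theorem exists_nhds_dimH_image_le {E F : Type*} [NormedAddCommGroup E] [NormedSpace ℝ E]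
    [FiniteDimensional ℝ E] [NormedAddCommGroup F] [NormedSpace ℝ F] [FiniteDimensional ℝ F]
    {g : E → F} {U : Set E} (hU : IsOpen U) (hg : ContDiffOn ℝ ∞ g U) {r : ℕ}
    (hr : ∀ x ∈ U, finrank ℝ (fderiv ℝ g x).range = r) {x₀ : E} (hx₀ : x₀ ∈ U) :
    ∃ V ∈ 𝓝 x₀, dimH (g '' V) ≤ r := by
  have hne : (∞ : WithTop ℕ∞) ≠ 0 := by simp
  have hgat : ∀ x ∈ U, HasFDerivAt g (fderiv ℝ g x) x := fun x hx =>
    ((hg.contDiffAt (hU.mem_nhds hx)).differentiableAt hne).hasFDerivAt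
  set D := fderiv ℝ g x₀ with hD
  set S : Submodule ℝ F := D.range
  obtain ⟨p', hp'⟩ := S.subtype.exists_leftInverse_of_injective S.ker_subtype
  set p : F →L[ℝ] S := p'.toContinuousLinearMap
  have hp : ∀ s : S, p s = s := fun s => LinearMap.congr_fun hp' s
  set L : E →L[ℝ] S := p.comp D with hLdef
  have hLs : Function.Surjective L := by
    rintro ⟨_, x, rfl⟩
    exact ⟨x, hp ⟨D x, x, rfl⟩⟩
  obtain ⟨Φ, hxs, hsU, hΦ, hΦs, hLΦ⟩ := exists_straightening hU (p.contDiff.comp_contDiffOn hg)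
    hx₀ (p.hasFDerivAt.comp x₀ (hgat x₀ hx₀)) hLs
  obtain ⟨σ', hσ'⟩ := L.toLinearMap.exists_rightInverse_of_surjective
    (LinearMap.range_eq_top.2 hLs)
  set σ : S →L[ℝ] E := σ'.toContinuousLinearMap
  have hσ : ∀ r, L (σ r) = r := fun r => LinearMap.congr_fun hσ' r
  set y₀ := Φ x₀
  set H : E → F := g ∘ Φ.symm with hH
  have hHc : ContDiffOn ℝ ∞ H Φ.target := hg.comp hΦs fun y hy => hsU (Φ.map_target hy)
  have hHat : ∀ y ∈ Φ.target, HasFDerivAt H (fderiv ℝ H y) y := fun y hy =>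
    ((hHc.contDiffAt (Φ.open_target.mem_nhds hy)).differentiableAt hne).hasFDerivAt
  have hpH : ∀ y ∈ Φ.target, p.comp (fderiv ℝ H y) = L := by
    intro y hy
    have h1 : HasFDerivAt (p ∘ H) (p.comp (fderiv ℝ H y)) y := p.hasFDerivAt.comp y (hHat y hy)
    have h2 : HasFDerivAt (fun y => L (y - y₀) + p (g x₀)) L y := by
      simpa using (L.hasFDerivAt.comp y ((hasFDerivAt_id y).sub_const y₀)).add_const (p (g x₀))
    refine h1.unique (h2.congr_of_eventuallyEq ?_)
    filter_upwards [Φ.open_target.mem_nhds hy] with w hw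
    have := hLΦ (Φ.symm w)
    rw [Φ.right_inv hw] at this
    simp only [Function.comp_apply, hH] at this ⊢
    rw [this]; abel
  have hrank : ∀ y ∈ Φ.target, finrank ℝ (fderiv ℝ H y).range ≤ r := by
    intro y hy
    have hx := hsU (Φ.map_target hy)
    have h1 : HasFDerivAt Φ.symm (fderiv ℝ Φ.symm y) y :=
      ((hΦs.contDiffAt (Φ.open_target.mem_nhds hy)).differentiableAt hne).hasFDerivAt
    rw [((hgat _ hx).comp y h1).fderiv, ← hr _ hx]
    refine Submodule.finrank_mono ?_
    rintro _ ⟨v, rfl⟩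
    exact ⟨_, rfl⟩
  -- `p ∘ DH = L` gives `ker DH ≤ ker L`; since `rank DH ≤ r = rank L`, the two kernels coincide.
  have hker : ∀ y ∈ Φ.target, ∀ v, L v = 0 → fderiv ℝ H y v = 0 := by
    intro y hy v hv
    set T := fderiv ℝ H y with hT
    have hTL : ∀ v, p (T v) = L v := fun v => by rw [← hpH y hy]; rfl
    have hle : T.ker ≤ L.ker := by
      intro w hw
      have hw' : T w = 0 := hw
      change L w = 0
      rw [← hTL, hw', map_zero]
    have h1 := T.toLinearMap.finrank_range_add_finrank_ker
    have h2 := L.toLinearMap.finrank_range_add_finrank_ker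
    have h3 : finrank ℝ L.range = r := by
      rw [← hr x₀ hx₀, LinearMap.range_eq_top.2 hLs, finrank_top]
    have h4 := hrank y hy
    have heq : T.ker = L.ker := Submodule.eq_of_le_of_finrank_le hle (by
      change finrank ℝ T.toLinearMap.range ≤ r at h4
      change finrank ℝ L.toLinearMap.range = r at h3
      change finrank ℝ L.toLinearMap.ker ≤ finrank ℝ T.toLinearMap.ker
      omega)
    have : v ∈ L.ker := hv
    rw [← heq] at this
    exact this
  obtain ⟨ε, hε, hball⟩ := Metric.isOpen_iff.1 Φ.open_target y₀ (Φ.map_source hxs)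
  set B := Metric.ball y₀ ε
  -- `q` projects along `ker L` onto the slice `y₀ + range σ`. The segment from `q y` to `y` has
  -- direction in `ker L`, so `H` is constant on it and its values are already taken on the
  -- `r`-dimensional slice.
  set q : E → E := fun y => y₀ + σ (L (y - y₀)) with hq
  have hqc : Continuous q := by fun_prop
  have hconst : ∀ y ∈ B, q y ∈ B → H y = H (q y) := by
    intro y hy hqy
    have hseg : ∀ t ∈ Set.Icc (0:ℝ) 1, AffineMap.lineMap (k := ℝ) (q y) y t ∈ B := fun t ht =>
      (convex_ball y₀ ε).lineMap_mem hqy hy ht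
    have hder : ∀ t ∈ Set.Icc (0:ℝ) 1,
        HasDerivWithinAt (fun t => H (AffineMap.lineMap (k := ℝ) (q y) y t)) 0 (Set.Icc 0 1) t := by
      intro t ht
      have h1 := hHat _ (hball (hseg t ht))
      have h2 : HasDerivAt (fun t : ℝ => AffineMap.lineMap (k := ℝ) (q y) y t) (y - q y) t := by
        simpa using AffineMap.hasDerivAt_lineMap (a := q y) (b := y) (x := t)
      have h3 := h1.comp_hasDerivAt t h2
      rw [hker _ (hball (hseg t ht)) (y - q y) ?_] at h3
      · exact h3.hasDerivWithinAt
      · simp [hq, map_sub, map_add, hσ]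
    have := constant_of_derivWithin_zero (f := fun t => H (AffineMap.lineMap (k := ℝ) (q y) y t))
      (a := 0) (b := 1)
      (fun t ht => (hder t ht).differentiableWithinAt)
      (fun t ht => (hder t (Ico_subset_Icc_self ht)).derivWithin
        ((uniqueDiffOn_Icc (zero_lt_one' ℝ)) t (Ico_subset_Icc_self ht)))
    simpa using this 1 (by simp)
  have hqy₀ : q y₀ = y₀ := by simp [hq]
  have hBn : B ∈ 𝓝 y₀ := Metric.ball_mem_nhds y₀ hε
  refine ⟨Φ.source ∩ Φ ⁻¹' (B ∩ q ⁻¹' B), Filter.inter_mem (Φ.open_source.mem_nhds hxs)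
    ((Φ.continuousAt hxs).preimage_mem_nhds (Filter.inter_mem hBn
      (hqc.continuousAt.preimage_mem_nhds (by rw [hqy₀]; exact hBn)))), ?_⟩
  set τ : S → E := fun s => y₀ + σ s with hτ
  have hτc : ContDiff ℝ ∞ τ := contDiff_const.add σ.contDiff
  have hconv : Convex ℝ (τ ⁻¹' B) := by
    have := ((convex_ball y₀ ε).translate_preimage_right y₀).linear_preimage σ.toLinearMap
    exact this
  have hsub : g '' (Φ.source ∩ Φ ⁻¹' (B ∩ q ⁻¹' B)) ⊆ (H ∘ τ) '' (τ ⁻¹' B) := by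
    rintro _ ⟨x, ⟨hx, hxB, hxq⟩, rfl⟩
    refine ⟨L (Φ x - y₀), hxq, ?_⟩
    have := hconst _ hxB hxq
    simp only [hH, Function.comp_apply, Φ.left_inv hx] at this
    exact this.symm
  calc dimH (g '' _) ≤ dimH ((H ∘ τ) '' (τ ⁻¹' B)) := dimH_mono hsub
    _ ≤ dimH (τ ⁻¹' B) := ContDiffOn.dimH_image_le (s := τ ⁻¹' B)
        (((hHc.mono hball).comp hτc.contDiffOn fun s hs => hs).of_le (by simp)) hconv le_rfl
    _ ≤ dimH (Set.univ : Set S) := dimH_mono (Set.subset_univ _)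
    _ = finrank ℝ S := Real.dimH_univ_eq_finrank S
    _ = r := by rw [← hr x₀ hx₀]

/-! ### Rank of a differential and dimension of the image -/

section Rank

variable {E₁ E₂ E₃ : Type*}
  [NormedAddCommGroup E₁] [NormedSpace ℝ E₁] [FiniteDimensional ℝ E₁]
  [NormedAddCommGroup E₂] [NormedSpace ℝ E₂] [FiniteDimensional ℝ E₂]
  [NormedAddCommGroup E₃] [NormedSpace ℝ E₃] [FiniteDimensional ℝ E₃]
  {X : Type*} [TopologicalSpace X] [ChartedSpace E₁ X]
  {Y : Type*} [TopologicalSpace Y] [ChartedSpace E₂ Y]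
  {Z : Type*} [TopologicalSpace Z] [ChartedSpace E₃ Z]

variable (E₁ E₂) in
/-- The rank at `x` of the differential of a map between manifolds. -/
noncomputable def diffRank (f : X → Y) (x : X) : ℕ :=
  finrank ℝ (LinearMap.range (M := E₁) (M₂ := E₂) (R := ℝ) (R₂ := ℝ) (τ₁₂ := RingHom.id ℝ)
    (mfderiv 𝓘(ℝ, E₁) 𝓘(ℝ, E₂) f x : E₁ →L[ℝ] E₂).toLinearMap)

omit [FiniteDimensional ℝ E₁] [FiniteDimensional ℝ E₂] in
theorem diffRank_congr {f g : X → Y} {x : X} (h : f =ᶠ[𝓝 x] g) :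
    diffRank E₁ E₂ f x = diffRank E₁ E₂ g x := by
  rw [diffRank, diffRank, h.mfderiv_eq]

omit [FiniteDimensional ℝ E₁] [FiniteDimensional ℝ E₂] in
theorem diffRank_comp_le_left {f : X → Y} {g : Y → Z} {x : X}
    (hf : MDifferentiableAt 𝓘(ℝ, E₁) 𝓘(ℝ, E₂) f x)
    (hg : MDifferentiableAt 𝓘(ℝ, E₂) 𝓘(ℝ, E₃) g (f x)) :
    diffRank E₁ E₃ (g ∘ f) x ≤ diffRank E₂ E₃ g (f x) := by
  rw [diffRank, mfderiv_comp x hg hf]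
  exact Submodule.finrank_mono (LinearMap.range_comp_le_range
    (mfderiv 𝓘(ℝ, E₁) 𝓘(ℝ, E₂) f x : E₁ →L[ℝ] E₂).toLinearMap
    (mfderiv 𝓘(ℝ, E₂) 𝓘(ℝ, E₃) g (f x) : E₂ →L[ℝ] E₃).toLinearMap)

omit [FiniteDimensional ℝ E₁] [FiniteDimensional ℝ E₃] in
theorem diffRank_comp_le_right {f : X → Y} {g : Y → Z} {x : X}
    (hf : MDifferentiableAt 𝓘(ℝ, E₁) 𝓘(ℝ, E₂) f x)
    (hg : MDifferentiableAt 𝓘(ℝ, E₂) 𝓘(ℝ, E₃) g (f x)) :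
    diffRank E₁ E₃ (g ∘ f) x ≤ diffRank E₁ E₂ f x := by
  rw [diffRank, mfderiv_comp x hg hf]
  have key : ∀ (f' : E₁ →L[ℝ] E₂) (g' : E₂ →L[ℝ] E₃),
      finrank ℝ (LinearMap.range (g'.toLinearMap ∘ₗ f'.toLinearMap)) ≤
        finrank ℝ (LinearMap.range f'.toLinearMap) := fun f' g' => by
    rw [LinearMap.range_comp]
    exact Submodule.finrank_map_le _ _
  exact key (mfderiv 𝓘(ℝ, E₁) 𝓘(ℝ, E₂) f x) (mfderiv 𝓘(ℝ, E₂) 𝓘(ℝ, E₃) g (f x))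

omit [FiniteDimensional ℝ E₁] in
/-- The rank of a map can be computed in a chart of the source. -/
theorem finrank_range_fderiv_comp_symm [IsManifold 𝓘(ℝ, E₁) ∞ X] {f : X → E₂} {x : X} {u : E₁}
    (hu : u ∈ (chartAt E₁ x).target)
    (hf : MDifferentiableAt 𝓘(ℝ, E₁) 𝓘(ℝ, E₂) f ((chartAt E₁ x).symm u)) :
    finrank ℝ (fderiv ℝ (f ∘ (chartAt E₁ x).symm) u).range =
      diffRank E₁ E₂ f ((chartAt E₁ x).symm u) := by
  set c := chartAt E₁ x
  have hm := IsManifold.chart_mem_maximalAtlas (I := 𝓘(ℝ, E₁)) (n := ∞) x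
  have hne : (∞ : WithTop ℕ∞) ≠ 0 := by simp
  have hw := c.map_target hu
  have hcs : MDifferentiableAt 𝓘(ℝ, E₁) 𝓘(ℝ, E₁) c.symm u :=
    (contMDiffAt_symm_of_mem_maximalAtlas hm hu).mdifferentiableAt hne
  have hc : MDifferentiableAt 𝓘(ℝ, E₁) 𝓘(ℝ, E₁) c (c.symm u) :=
    (contMDiffAt_of_mem_maximalAtlas hm hw).mdifferentiableAt hne
  have hcu : c (c.symm u) = u := c.right_inv hu
  have heq : (f ∘ c.symm) ∘ c =ᶠ[𝓝 (c.symm u)] f := by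
    filter_upwards [c.open_source.mem_nhds hw] with w hw
    simp [c.left_inv hw]
  have h0 : finrank ℝ (fderiv ℝ (f ∘ c.symm) u).range = diffRank E₁ E₂ (f ∘ c.symm) u := by
    rw [diffRank, mfderiv_eq_fderiv]
  rw [h0]
  refine le_antisymm (diffRank_comp_le_left hcs hf) ?_
  have h1 := diffRank_comp_le_left (f := c) (g := f ∘ c.symm) (x := c.symm u) hc
    (by rw [hcu]; exact hf.comp u hcs)
  rwa [diffRank_congr heq, hcu] at h1

open Set in
/-- The image of a smooth map of constant rank `r` defined on an open set of a second countable
manifold has dimension at most `r`. -/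
theorem dimH_image_le_of_diffRank_eq [IsManifold 𝓘(ℝ, E₁) ∞ X] [SecondCountableTopology X]
    {f : X → E₂} {A : Set X} (hA : IsOpen A) (hf : ContMDiffOn 𝓘(ℝ, E₁) 𝓘(ℝ, E₂) ∞ f A) {r : ℕ}
    (hr : ∀ x ∈ A, diffRank E₁ E₂ f x = r) : dimH (f '' A) ≤ r := by
  have hne : (∞ : WithTop ℕ∞) ≠ 0 := by simp
  have key : ∀ x ∈ A, ∃ V ∈ 𝓝 x, dimH (f '' V) ≤ r := by
    intro x hx
    set c := chartAt E₁ x with hc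
    have hm := IsManifold.chart_mem_maximalAtlas (I := 𝓘(ℝ, E₁)) (n := ∞) x
    have hxs : x ∈ c.source := mem_chart_source E₁ x
    obtain ⟨V, hV, hd⟩ := exists_nhds_dimH_image_le (g := f ∘ c.symm) (r := r)
      (c.isOpen_inter_preimage_symm hA)
      (contMDiffOn_iff_contDiffOn.1 (hf.comp ((contMDiffOn_symm_of_mem_maximalAtlas hm).mono
        inter_subset_left) fun u hu => hu.2))
      (fun u hu => by
        rw [finrank_range_fderiv_comp_symm hu.1
          ((hf.contMDiffAt (hA.mem_nhds hu.2)).mdifferentiableAt hne), hr _ hu.2])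
      (x₀ := c x) ⟨c.map_source hxs, by simpa [c.left_inv hxs] using hx⟩
    refine ⟨c.source ∩ c ⁻¹' V, Filter.inter_mem (c.open_source.mem_nhds hxs)
      ((c.continuousAt hxs).preimage_mem_nhds hV), (dimH_mono ?_).trans hd⟩
    rintro _ ⟨y, ⟨hy, hyV⟩, rfl⟩
    exact ⟨c y, hyV, by simp [c.left_inv hy]⟩
  choose! V hV hd using key
  -- Hausdorff dimension is stable under countable unions only, hence the need for second
  -- countability.
  obtain ⟨t, htA, htc, hcov⟩ := TopologicalSpace.countable_cover_nhdsWithin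
    (fun x hx => mem_nhdsWithin_of_mem_nhds (hV x hx))
  calc dimH (f '' A) ≤ dimH (⋃ x ∈ t, f '' V x) := dimH_mono (by
        rw [← image_iUnion₂]; exact image_mono hcov)
    _ = ⨆ x ∈ t, dimH (f '' V x) := dimH_bUnion htc _
    _ ≤ r := iSup₂_le fun x hx => hd x (htA hx)

end Rank

/-! ### Fibres of submersions as embedded submanifolds -/

section Charts

variable {E X : Type*} [NormedAddCommGroup E] [NormedSpace ℝ E] [TopologicalSpace X]
  [ChartedSpace E X]

/-- Composing a chart of the maximal atlas with a smooth local diffeomorphism of the model space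
gives a chart of the maximal atlas. -/
theorem trans_mem_maximalAtlas [IsManifold 𝓘(ℝ, E) ∞ X] {c : OpenPartialHomeomorph X E}
    (hc : c ∈ IsManifold.maximalAtlas 𝓘(ℝ, E) ∞ X) {Φ : OpenPartialHomeomorph E E}
    (h : ContDiffOn ℝ ∞ Φ Φ.source) (h' : ContDiffOn ℝ ∞ Φ.symm Φ.target) :
    c.trans Φ ∈ IsManifold.maximalAtlas 𝓘(ℝ, E) ∞ X := by
  have hΦ : Φ ∈ contDiffGroupoid ∞ 𝓘(ℝ, E) := by
    rw [contDiffGroupoid, mem_groupoid_of_pregroupoid]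
    simpa [contDiffPregroupoid] using ⟨h, h'⟩
  rw [IsManifold.mem_maximalAtlas_iff, mem_maximalAtlas_iff]
  intro e he
  have hm := IsManifold.subset_maximalAtlas (I := 𝓘(ℝ, E)) (n := ∞) he
  have h1 := IsManifold.compatible_of_mem_maximalAtlas hc hm
  have h2 := IsManifold.compatible_of_mem_maximalAtlas hm hc
  constructor
  · rw [OpenPartialHomeomorph.trans_symm_eq_symm_trans_symm, OpenPartialHomeomorph.trans_assoc]
    exact StructureGroupoid.trans _ (StructureGroupoid.symm _ hΦ) h1
  · rw [← OpenPartialHomeomorph.trans_assoc]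
    exact StructureGroupoid.trans _ h2 hΦ

/-- A set which near each of its points is a fibre of a map with surjective differential is an
embedded submanifold. -/
theorem isEmbeddedSubmanifold_of_diffRank_eq [FiniteDimensional ℝ E] [IsManifold 𝓘(ℝ, E) ∞ X]
    {F : Type*} [NormedAddCommGroup F] [NormedSpace ℝ F] [FiniteDimensional ℝ F]
    {S A : Set X} (hA : IsOpen A) {f : X → F} (hf : ContMDiffOn 𝓘(ℝ, E) 𝓘(ℝ, F) ∞ f A)
    (hr : ∀ x ∈ A, diffRank E F f x = finrank ℝ F) (hSA : S ⊆ A) {v : F}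
    (hS : ∀ x ∈ A, x ∈ S ↔ f x = v) :
    IsEmbeddedSubmanifold (E := E) S (finrank ℝ E - finrank ℝ F) := by
  intro x hx
  have hxA := hSA hx
  have hne : (∞ : WithTop ℕ∞) ≠ 0 := by simp
  set c := chartAt E x with hc
  have hm := IsManifold.chart_mem_maximalAtlas (I := 𝓘(ℝ, E)) (n := ∞) x
  have hxs : x ∈ c.source := mem_chart_source E x
  have hxt := c.map_source hxs
  have hU := c.isOpen_inter_preimage_symm hA
  have hg : ContDiffOn ℝ ∞ (f ∘ c.symm) (c.target ∩ c.symm ⁻¹' A) :=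
    contMDiffOn_iff_contDiffOn.1 (hf.comp ((contMDiffOn_symm_of_mem_maximalAtlas hm).mono
      Set.inter_subset_left) fun u hu => hu.2)
  have hxU : c x ∈ c.target ∩ c.symm ⁻¹' A := ⟨hxt, by simpa [c.left_inv hxs] using hxA⟩
  have hrk := finrank_range_fderiv_comp_symm (f := f) hxt
    ((hf.contMDiffAt (hA.mem_nhds hxU.2)).mdifferentiableAt hne)
  rw [hr _ hxU.2] at hrk
  set L := fderiv ℝ (f ∘ c.symm) (c x) with hL
  have hs : L.range = ⊤ := Submodule.eq_top_of_finrank_eq hrk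
  obtain ⟨Φ, hxΦ, hsU, hΦ, hΦs, hLΦ⟩ := exists_straightening hU hg hxU
    ((hg.contDiffAt (hU.mem_nhds hxU)).differentiableAt hne).hasFDerivAt
    (LinearMap.range_eq_top.1 hs)
  refine ⟨c.trans Φ, trans_mem_maximalAtlas hm hΦ hΦs, ?_, L.ker, inferInstance, ?_, ?_⟩
  · rw [OpenPartialHomeomorph.trans_source]
    exact ⟨hxs, hxΦ⟩
  · have := L.toLinearMap.finrank_range_add_finrank_ker
    change finrank ℝ L.toLinearMap.range = _ at hrk
    change finrank ℝ L.toLinearMap.ker = _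
    omega
  · intro y hy
    rw [OpenPartialHomeomorph.trans_source] at hy
    obtain ⟨hyc, hyΦ⟩ := hy
    have hyA : y ∈ A := by simpa [c.left_inv hyc] using (hsU hyΦ).2
    have h := hLΦ (c y)
    simp only [Function.comp_apply, c.left_inv hyc, c.left_inv hxs] at h
    change _ ↔ L (Φ (c y) - Φ (c x)) = 0
    rw [h, hS y hyA, (hS x hxA).1 hx, sub_eq_zero]

end Charts

/-- Around a point `x`, the fibre of a submersion through `x` is parametrized by an open set of the
complement. -/
theorem Manifold.IsSubmersionAtOfComplement.exists_fibre_chart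
    {E E' F X Y : Type*} [NormedAddCommGroup E] [NormedSpace ℝ E] [NormedAddCommGroup E']
    [NormedSpace ℝ E'] [NormedAddCommGroup F] [NormedSpace ℝ F]
    [TopologicalSpace X] [ChartedSpace E X] [IsManifold 𝓘(ℝ, E) ∞ X]
    [TopologicalSpace Y] [ChartedSpace E' Y] {f : X → Y} {x : X}
    (h : IsSubmersionAtOfComplement F 𝓘(ℝ, E) 𝓘(ℝ, E') ∞ f x) :
    ∃ (U : Set X) (T : Set F) (π : X → F) (j : F → X), IsOpen U ∧ IsOpen T ∧ x ∈ U ∧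
      ContMDiffOn 𝓘(ℝ, E) 𝓘(ℝ, F) ∞ π U ∧ ContMDiffOn 𝓘(ℝ, F) 𝓘(ℝ, E) ∞ j T ∧
      (∀ w ∈ U, f w = f x → π w ∈ T ∧ j (π w) = w) ∧
      ∀ v ∈ T, j v ∈ U ∧ f (j v) = f x ∧ π (j v) = v := by
  set φ := h.domChart with hφ
  set χ := h.codChart
  set A := h.equiv
  have hx : x ∈ φ.source := h.mem_domChart_source
  have hmap : ∀ w ∈ φ.source, f w ∈ χ.source := h.source_subset_preimage_source
  have hfst : ∀ w ∈ φ.source, χ (f w) = (A (φ w)).1 := by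
    intro w hw
    have ht : φ w ∈ (φ.extend 𝓘(ℝ, E)).target := by simpa using φ.map_source hw
    have := h.writtenInCharts ht
    simpa [φ.left_inv hw, ← hφ] using this
  -- In these charts `f` is the first projection, so its fibre through `x` is the slice `{c} × F`.
  set c := (A (φ x)).1
  have hk : ContDiff ℝ ∞ fun v : F => A.symm (c, v) :=
    A.symm.contDiff.comp (contDiff_const.prodMk contDiff_id)
  refine ⟨φ.source, (fun v => A.symm (c, v)) ⁻¹' φ.target, fun w => (A (φ w)).2,
    fun v => φ.symm (A.symm (c, v)), φ.open_source, φ.open_target.preimage hk.continuous, hx,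
    ?_, ?_, ?_, ?_⟩
  · exact (contDiff_snd.comp A.contDiff).contMDiff.comp_contMDiffOn
      (contMDiffOn_of_mem_maximalAtlas h.domChart_mem_maximalAtlas)
  · exact (contMDiffOn_symm_of_mem_maximalAtlas h.domChart_mem_maximalAtlas).comp
      hk.contMDiff.contMDiffOn fun v hv => hv
  · intro w hw hwx
    have h1 : A.symm (c, (A (φ w)).2) = φ w := by
      rw [A.symm_apply_eq]
      exact Prod.ext (by rw [← hfst w hw, hwx, hfst x hx]) rfl
    refine ⟨?_, ?_⟩
    · simpa [h1] using φ.map_source hw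
    · simp [h1, φ.left_inv hw]
  · intro v hv
    have hw := φ.map_target hv
    have h1 : A (φ (φ.symm (A.symm (c, v)))) = (c, v) := by
      rw [φ.right_inv hv, A.apply_symm_apply]
    refine ⟨hw, χ.injOn (hmap _ hw) (hmap _ hx) ?_, by simp [h1]⟩
    rw [hfst _ hw, hfst _ hx, h1]

/-! ### Orbit maps and stabilizers -/

theorem proposition11
    {E : Type*} [NormedAddCommGroup E] [NormedSpace ℝ E] [FiniteDimensional ℝ E]
    {EN : Type*} [NormedAddCommGroup EN] [NormedSpace ℝ EN] [FiniteDimensional ℝ EN]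
    {EO : Type*} [NormedAddCommGroup EO] [NormedSpace ℝ EO] [FiniteDimensional ℝ EO]
    {M : Type*} [TopologicalSpace M] [T2Space M]
    [ChartedSpace E M] [IsManifold 𝓘(ℝ, E) ∞ M]
    {N : Type*} [TopologicalSpace N] [T2Space N] [Nonempty N]
    [ChartedSpace EN N] [IsManifold 𝓘(ℝ, EN) ∞ N]
    {O : Type*} [Group O] [TopologicalSpace O] [T2Space O] [SecondCountableTopology O]
    [ChartedSpace EO O] [LieGroup 𝓘(ℝ, EO) ∞ O]
    (sp : SSpace E EN EO M N O) :
    ∃ s : ℕ,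
      (∀ z : N, IsEmbeddedSubmanifold (E := EO) (sp.stabilizer z : Set O) s) ∧
      (Module.finrank ℝ EN : ℤ) = Module.finrank ℝ E + Module.finrank ℝ EO - s := by
  -- A single complement `F` serves all points of `N`, which makes `s` independent of `z`.
  obtain ⟨F, _, _, hψ⟩ := sp.isSubmersion_ψ
  have hne : (∞ : WithTop ℕ∞) ≠ 0 := by simp
  have A := (hψ (Classical.arbitrary N)).equiv
  have hfinF : FiniteDimensional ℝ F := FiniteDimensional.of_injective
    (A.symm.toLinearMap ∘ₗ LinearMap.inr ℝ E F) (A.symm.injective.comp LinearMap.inr_injective)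
  have hdim : finrank ℝ EN = finrank ℝ E + finrank ℝ F := by
    rw [A.toLinearEquiv.finrank_eq, finrank_prod]
  have key : ∀ z : N, finrank ℝ F ≤ finrank ℝ EO ∧ IsEmbeddedSubmanifold (E := EO)
      (sp.stabilizer z : Set O) (finrank ℝ EO - finrank ℝ F) := by
    intro z
    obtain ⟨U, T, π, j, hU, hT, hzU, hπ, hj, hUT, hTU⟩ := (hψ z).exists_fibre_chart
    set θ : O → N := sp.R z
    have hθ : ContMDiff 𝓘(ℝ, EO) 𝓘(ℝ, EN) ∞ θ :=
      sp.contMDiff_R.comp (contMDiff_const.prodMk contMDiff_id)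
    have hRb : ∀ b, ContMDiff 𝓘(ℝ, EN) 𝓘(ℝ, EN) ∞ fun w => sp.R w b := fun b =>
      sp.contMDiff_R.comp (contMDiff_id.prodMk contMDiff_const)
    have hrank_le : ∀ a b, diffRank EO EN θ a ≤ diffRank EO EN θ (a * b) := by
      intro a b
      -- Equivariance: `z.a = (z.(ab)).b⁻¹`. Rank cannot increase under composition.
      have heq : θ = (fun w => sp.R w b⁻¹) ∘ θ ∘ fun a => a * b := by
        ext a
        simp [θ, ← sp.R_mul]
      have hb : ContMDiff 𝓘(ℝ, EO) 𝓘(ℝ, EO) ∞ fun a : O => a * b := contMDiff_mul_right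
      conv_lhs => rw [heq]
      exact (diffRank_comp_le_right ((hθ.comp hb).mdifferentiable hne a)
        ((hRb b⁻¹).mdifferentiable hne _)).trans
        (diffRank_comp_le_left (hb.mdifferentiable hne a) (hθ.mdifferentiable hne _))
    have hrank : ∀ a, diffRank EO EN θ a = diffRank EO EN θ 1 := fun a => le_antisymm
      (by simpa using hrank_le a a⁻¹) (by simpa using hrank_le 1 a)
    set B := θ ⁻¹' U
    have hB : IsOpen B := hU.preimage hθ.continuous
    set g : O → F := π ∘ θ with hg_def
    have hg : ContMDiffOn 𝓘(ℝ, EO) 𝓘(ℝ, F) ∞ g B := hπ.comp hθ.contMDiffOn fun a ha => ha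
    have hgT : ∀ a ∈ B, g a ∈ T ∧ j (g a) = θ a := fun a ha => hUT _ ha (sp.ψ_R z a)
    have hgrank : ∀ a ∈ B, diffRank EO F g a = diffRank EO EN θ 1 := by
      intro a ha
      rw [← hrank a]
      refine le_antisymm (diffRank_comp_le_right (hθ.mdifferentiable hne a)
        ((hπ.contMDiffAt (hU.mem_nhds ha)).mdifferentiableAt hne)) ?_
      -- Passing to the coordinate `π` loses no rank, because `j` recovers `θ` from `g`.
      have heq : θ =ᶠ[𝓝 a] j ∘ g := by
        filter_upwards [hB.mem_nhds ha] with b hb using (hgT b hb).2.symm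
      rw [diffRank_congr heq]
      exact diffRank_comp_le_right ((hg.contMDiffAt (hB.mem_nhds ha)).mdifferentiableAt hne)
        ((hj.contMDiffAt (hT.mem_nhds (hgT a ha).1)).mdifferentiableAt hne)
    have hTg : T ⊆ g '' B := by
      intro v hv
      obtain ⟨h1, h2, h3⟩ := hTU v hv
      obtain ⟨a, ha⟩ := sp.transitive z (j v) h2.symm
      have ha' : θ a = j v := ha
      exact ⟨a, by simpa [B, ha'] using h1, by simp [hg_def, ha', h3]⟩
    have h1B : (1 : O) ∈ B := by simpa [B, θ, sp.R_one] using hzU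
    have hdT : dimH T = finrank ℝ F := Real.dimH_of_mem_nhds (hT.mem_nhds (hgT 1 h1B).1)
    have hle : finrank ℝ F ≤ diffRank EO EN θ 1 := by
      have := (dimH_mono hTg).trans (dimH_image_le_of_diffRank_eq hB hg hgrank)
      rw [hdT] at this
      exact_mod_cast this
    have hge : ∀ a, diffRank EO F g a ≤ finrank ℝ F := fun a => Submodule.finrank_le _
    have hfull : ∀ a ∈ B, diffRank EO F g a = finrank ℝ F := fun a ha =>
      le_antisymm (hge a) (hle.trans_eq (hgrank a ha).symm)
    refine ⟨?_, isEmbeddedSubmanifold_of_diffRank_eq hB hg hfull (v := π z) ?_ ?_⟩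
    · rw [← hfull 1 h1B]
      exact LinearMap.finrank_range_le _
    · intro a ha
      have ha' : θ a = z := ha
      simpa [B, ha'] using hzU
    · intro a ha
      refine ⟨fun h => congrArg π h, fun h => ?_⟩
      have h1 := (hgT a ha).2
      rw [h, (hUT z hzU rfl).2] at h1
      exact h1.symm
  -- The truncated subtraction is a true one, since `key` gives `dim F ≤ dim O`.
  refine ⟨finrank ℝ EO - finrank ℝ F, fun z => (key z).2, ?_⟩
  have := (key (Classical.arbitrary N)).1
  omega
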